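/- A matrix $D\in\mathbb R^{n\times d}$ is called a tight frame for $\mathbb R^n$ if its columns satisfy $f=\sum_k\langle f,D_k\rangle D_k$ for all $f\in\mathbb R^n$. For a vector $x$, $x_{[k]}$ keeps the $k$ entries of largest magnitude and sets the others to zero, $\|x\|_0$ is the number of nonzero entries, and $\|B\|_{1,1}$ is the norm of a matrix $B$ as an operator from $\ell_1$ to $\ell_1$. There are absolute constants $C,c>0$, and for every $\delta\in(0,1/4)$ there are constants $C_0,\dots,C_5>0$ depending only on $\delta$, such that the following holds. Let $D\in\mathbb R^{n\times d}$ and $\Omega\in\mathbb R^{m\times M}$ be tight frames for $\mathbb R^n$ and $\mathbb R^m$, let $s,s'\ge 0$ be integers with $1\le s+s'\le (d+M)/2$, and suppose that $$m\ \ge\ C\delta^{-2}(s+s')\log\frac{d+M}{s+s'} .$$ Let $A\in\mathbb R^{m\times n}$ have i.i.d. entries with law $N(0,1/m)$, and put $\Phi=[A,I]\in\mathbb R^{m\times(n+m)}$ and $W=\begin{pmatrix}D&0\\0&\Omega\end{pmatrix}$. Then, with probability at least $1-3e^{-cm}$, the following holds for all $f\in\mathbb R^n$ and $e,z\in\mathbb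 R^m$ with $\|\Omega^*e\|_0\le s'$, with $u=(f,e)$ and $y=Af+z+e=\Phi u+z$ (for any $\hat u\in\mathbb R^{n+m}$, $\hat f\in\mathbb R^n$ denotes its first component). (a) (SADS) If $\|W^*\Phi^*z\|_\infty\le\lambda$, then every minimizer $\hat u$ of $\|W^*\tilde u\|_1$ over all $\tilde u\in\mathbb R^{n+m}$ with $\|W^*\Phi^*(\Phi\tilde u-y)\|_\infty\le\lambda$ satisfies $$\|\hat f-f\|_2\le\|\hat u-u\|_2\le\min_{1\le k\le s}\Big[C_0\sqrt{k+s'}\,\lambda+C_1\frac{\|D^*f-(D^*f)_{[k]}\|_1}{\sqrt{k+s'}}\Big].$$ (b) (SALASSO) If $\mu>0$ and $\|W^*\Phi^*z\|_\infty\le\mu/2$, then every minimizer $\hat u$ of $\frac12\|\Phi\tilde u-y\|_2^2+\mu\|W^*\tilde u\|_1$ over $\tilde u\in\mathbb R^{n+m}$ satisfies $$\|\hat f-f\|_2\le\|\hat u-u\|_2\le\min_{1\le k\le s}\Big[C_2\big(1+2\|D^*D\|_{1,1}\big)\sqrt{k+s'}\,\mu+C_3\frac{\|D^*f-(D^*f)_{[k]}\|_1}{\sqrt{k+s'}}\Big].$$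 (c) (SABP) If $\|z\|_2\le\varepsilon$, then every minimizer $\hat u$ of $\|W^*\tilde u\|_1$ over all $\tilde u\in\mathbb R^{n+m}$ with $\|\Phi\tilde u-y\|_2\le\varepsilon$ satisfies $$\|\hat f-f\|_2\le\|\hat u-u\|_2\le C_4\varepsilon+C_5\frac{\|D^*f-(D^*f)_{[s]}\|_1}{\sqrt{s+s'}} .$$ (If $s=0$, the minima in (a) and (b) are over the empty set and only the first inequalities are asserted there.) -/

import Mathlib

open MeasureTheory ProbabilityTheory
open scoped Matrix NNReal

namespace SparseNoise

noncomputable section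

/-- The Euclidean norm of a finite real vector. -/
def l2Norm {ι : Type*} [Fintype ι] (x : ι → ℝ) : ℝ := ‖WithLp.toLp 2 x‖

/-- The `ℓ¹` norm of a finite real vector. -/
def l1Norm {ι : Type*} [Fintype ι] (x : ι → ℝ) : ℝ := ‖WithLp.toLp 1 x‖

/-- The `ℓ^∞` norm of a finite real vector (Mathlib's norm on a finite product). -/
def linftyNorm {ι : Type*} [Fintype ι] (x : ι → ℝ) : ℝ := ‖x‖

/-- `‖B‖_{1,1}`, the norm of `B` as an operator from `ℓ¹` to `ℓ¹`. -/
def norm11 {d : ℕ} (B : Matrix (Fin d) (Fin d) ℝ) : ℝ :=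
  ‖LinearMap.toContinuousLinearMap (Matrix.toLpLin 1 1 B)‖

/-- The columns `D_k` of `D` satisfy `f = ∑_k ⟨f, D_k⟩ D_k` for all `f`. -/
def IsTightFrame {n d : ℕ} (D : Matrix (Fin n) (Fin d) ℝ) : Prop :=
  ∀ f : Fin n → ℝ, f = ∑ k : Fin d, (f ⬝ᵥ D.col k) • D.col k

/-- `x_{[k]}`: the `k` entries of `x` of largest magnitude are kept (among entries of equal
magnitude, those of smaller index first), the others are set to zero. -/
def largest {d : ℕ} (k : ℕ) (x : Fin d → ℝ) : Fin d → ℝ := fun i =>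
  if (Finset.univ.filter fun j : Fin d =>
      |x i| < |x j| ∨ (|x j| = |x i| ∧ j < i)).card < k
  then x i else 0

/-- `Φ = [A, I]`. -/
def phi {m n : ℕ} (A : Matrix (Fin m) (Fin n) ℝ) : Matrix (Fin m) (Fin n ⊕ Fin m) ℝ :=
  Matrix.fromCols A 1

/-- `W = diag(D, Ω)`. -/
def blockFrame {n d m M : ℕ} (D : Matrix (Fin n) (Fin d) ℝ) (Ω : Matrix (Fin m) (Fin M) ℝ) :
    Matrix (Fin n ⊕ Fin m) (Fin d ⊕ Fin M) ℝ :=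
  Matrix.fromBlocks D 0 0 Ω

section Programs

variable {μ ν κ : Type*} [Fintype μ] [Fintype ν] [Fintype κ]

/-- `û` minimizes `obj` over the set `F`. -/
def IsSolution (obj : (ν → ℝ) → ℝ) (F : Set (ν → ℝ)) (û : ν → ℝ) : Prop :=
  û ∈ F ∧ ∀ v ∈ F, obj û ≤ obj v

/-- `û` is a solution of: minimize `‖W* v‖₁` subject to `‖Φ v - y‖₂ ≤ ε`. -/
def IsSABP (Φ : Matrix μ ν ℝ) (W : Matrix ν κ ℝ) (y : μ → ℝ) (ε : ℝ) (û : ν → ℝ) : Prop :=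
  IsSolution (fun v => l1Norm (Wᵀ *ᵥ v)) {v | l2Norm (Φ *ᵥ v - y) ≤ ε} û

/-- `û` is a solution of: minimize `‖W* v‖₁` subject to `‖W* Φ* (Φ v - y)‖_∞ ≤ lam`. -/
def IsSADS (Φ : Matrix μ ν ℝ) (W : Matrix ν κ ℝ) (y : μ → ℝ) (lam : ℝ) (û : ν → ℝ) : Prop :=
  IsSolution (fun v => l1Norm (Wᵀ *ᵥ v))
    {v | linftyNorm (Wᵀ *ᵥ (Φᵀ *ᵥ (Φ *ᵥ v - y))) ≤ lam} û

/-- `û` is a solution of: minimize `(1/2) ‖Φ v - y‖₂² + mu ‖W* v‖₁` over all `v`. -/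
def IsSALASSO (Φ : Matrix μ ν ℝ) (W : Matrix ν κ ℝ) (y : μ → ℝ) (mu : ℝ) (û : ν → ℝ) : Prop :=
  IsSolution (fun v => 1 / 2 * l2Norm (Φ *ᵥ v - y) ^ 2 + mu * l1Norm (Wᵀ *ᵥ v)) Set.univ û

end Programs

/-- The entries of the random matrix `A` are independent with law `N(0, 1/m)`. -/
def IsGaussianMatrix {S : Type*} [MeasurableSpace S] {m n : ℕ}
    (A : S → Matrix (Fin m) (Fin n) ℝ) (P : Measure S) : Prop :=
  (∀ i j, HasLaw (fun ω => A ω i j) (gaussianReal 0 (1 / (m : ℝ≥0))) P) ∧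
    iIndepFun (fun (p : Fin m × Fin n) ω => A ω p.1 p.2) P

end

end SparseNoise

open SparseNoise

/-! A constant-factor version of the restricted isometry property suffices, provided it holds at
sparsity `Q = 102400 (s + s')`. For fixed `(f, e)` the coordinates of `A f + e` are independent
Gaussians with means `e i`, so a Chernoff bound puts `‖A f + e‖²` within a factor 4 of `‖f‖² + ‖e‖²`
(`measureReal_sum_sq_gaussian_le`). Nets in the spans of `Q` columns of `W`, a union bound and the
lower bound on `m` extend this to all `Q`-sparse combinations, with constants 1/10 and 3
(`exists_test_vectors`, `choose_mul_pow_le_exp`).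

Since `W Wᵀ = 1`, any `h` splits into a `Q`-sparse head and a tail controlled by `‖Wᵀ h‖₁ / √Q`.
This yields `‖h‖₂ / 10 ≤ ‖Φ h‖₂ + 4 ‖Wᵀ h‖₁ / √Q` (`l2Norm_le_of_sparse_bounds`).

For each program, comparing the minimizer with `u` puts `h = û - u` in a cone where `‖Wᵀ h‖₁ ≤ 4 √K
‖h‖₂ + 4 R`. As `Q` is a large multiple of `K`, the `ℓ¹` term is absorbed (`l2Norm_le_of_cone`), and
it remains to bound `‖Φ h‖₂`. -/

/-! ### Gaussian matrices: moment generating functions and concentration -/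

/-- A finite sum of independent centred real Gaussians is a centred Gaussian. -/
lemma hasLaw_sum_gaussianReal {Ω ι : Type*} [MeasurableSpace Ω] {P : Measure Ω}
    {X : ι → Ω → ℝ} {v : ι → ℝ≥0} (hind : iIndepFun X P)
    (hX : ∀ i, HasLaw (X i) (gaussianReal 0 (v i)) P) (s : Finset ι) :
    HasLaw (∑ i ∈ s, X i) (gaussianReal 0 (∑ i ∈ s, v i)) P := by
  classical
  have := hind.isProbabilityMeasure
  induction s using Finset.induction_on with
  | empty =>
    have h0 : (∑ i ∈ (∅ : Finset ι), X i) = fun _ => (0 : ℝ) := by ext; simp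
    rw [h0]
    exact ⟨aemeasurable_const, by simp⟩
  | insert i s hi ih =>
    rw [Finset.sum_insert hi, Finset.sum_insert hi]
    refine ⟨(hX i).aemeasurable.add ih.aemeasurable, ?_⟩
    have h := gaussianReal_add_gaussianReal_of_indepFun
      (hind.indepFun_finsetSum_of_notMem₀ (fun j => (hX j).aemeasurable) hi).symm
      (hX i).map_eq ih.map_eq
    simpa using h

/-- The law of a matrix with independent entries of common law `γ`. -/
lemma map_matrix_eq_pi {Ω : Type*} [MeasurableSpace Ω] {P : Measure Ω} {m n : ℕ}
    {A : Ω → Matrix (Fin m) (Fin n) ℝ} {γ : Measure ℝ} [IsProbabilityMeasure γ]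
    (hA : ∀ i j, HasLaw (fun ω => A ω i j) γ P)
    (hind : iIndepFun (fun (p : Fin m × Fin n) ω => A ω p.1 p.2) P) :
    P.map (fun ω i j => A ω i j) =
      Measure.pi fun _ : Fin m => Measure.pi fun _ : Fin n => γ := by
  have h := hind.map_fun_eq_pi_map (fun p : Fin m × Fin n => (hA p.1 p.2).aemeasurable)
  simp only [fun p : Fin m × Fin n => (hA p.1 p.2).map_eq] at h
  have h2 := Measure.infinitePi_map_curry (fun (_ : Fin m) (_ : Fin n) => γ)
  simp only [Measure.infinitePi_eq_pi] at h2
  rw [← h2, ← h, AEMeasurable.map_map_of_aemeasurable]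
  · rfl
  · exact Measurable.aemeasurable (by fun_prop)
  · exact aemeasurable_pi_lambda _ fun p => (hA p.1 p.2).aemeasurable

/-- Multiplying a Gaussian density by `exp (t x²)` gives a multiple of a Gaussian density. -/
lemma gaussianPDFReal_mul_exp_sq (μ t : ℝ) (v : ℝ≥0) (hv : v ≠ 0) (ht : 2 * t * v < 1) (x : ℝ) :
    gaussianPDFReal μ v x * Real.exp (t * x ^ 2) =
      (√(1 - 2 * t * v))⁻¹ * Real.exp (t * μ ^ 2 / (1 - 2 * t * v)) *
      gaussianPDFReal (μ / (1 - 2 * t * v)) (v / (1 - 2 * t * v).toNNReal) x := by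
  have hq : 0 < 1 - 2 * t * v := by linarith
  have hv' : (0 : ℝ) < v := by positivity
  simp only [gaussianPDFReal, NNReal.coe_div, Real.coe_toNNReal _ hq.le]
  set q := 1 - 2 * t * v with hqdef
  have h1 : √(2 * Real.pi * (v / q)) = √(2 * Real.pi * v) / √q := by
    rw [← mul_div_assoc, Real.sqrt_div (by positivity)]
  have hs : 0 < √q := Real.sqrt_pos.2 hq
  rw [h1, mul_assoc, ← Real.exp_add]
  have h2 : -(x - μ) ^ 2 / (2 * v) + t * x ^ 2 =
      t * μ ^ 2 / q + -(x - μ / q) ^ 2 / (2 * (v / q)) := by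
    have : t = (1 - q) / (2 * v) := by rw [hqdef]; field_simp; ring
    rw [this]
    field_simp
    ring
  rw [h2, Real.exp_add]
  field_simp

lemma integrable_exp_mul_sq_gaussianReal (μ t : ℝ) (v : ℝ≥0) (ht : 2 * t * v < 1) :
    Integrable (fun x => Real.exp (t * x ^ 2)) (gaussianReal μ v) := by
  by_cases hv : v = 0
  · subst hv
    rw [gaussianReal_zero_var]
    exact integrable_dirac (by simp)
  · rw [gaussianReal_of_var_ne_zero _ hv,
      integrable_withDensity_iff_integrable_smul₀' (measurable_gaussianPDF _ _).aemeasurable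
        (ae_of_all _ fun _ => gaussianPDF_lt_top)]
    simp only [toReal_gaussianPDF, smul_eq_mul, gaussianPDFReal_mul_exp_sq μ t v hv ht]
    exact (integrable_gaussianPDFReal _ _).const_mul _

/-- With `q = 1 - 2 t v`, for `v ≠ 0` the exact value is `q^(-1/2) exp (t μ² / q)`, and `log q ≥ 1 -
1/q` bounds the first factor. Both signs of `t` are allowed, so one estimate serves both tails. -/
lemma mgf_sq_gaussianReal_le (μ t : ℝ) (v : ℝ≥0) (ht : 2 * t * v < 1) :
    mgf (fun x => x ^ 2) (gaussianReal μ v) t ≤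
      Real.exp (t * (μ ^ 2 + v) / (1 - 2 * t * v)) := by
  by_cases hv : v = 0
  · subst hv
    simp [mgf, gaussianReal_zero_var]
  · have hq : 0 < 1 - 2 * t * v := by linarith
    have hv' : v / (1 - 2 * t * v).toNNReal ≠ 0 := by
      refine div_ne_zero hv ?_
      simpa using hq
    rw [mgf, integral_gaussianReal_eq_integral_smul hv]
    simp only [smul_eq_mul, gaussianPDFReal_mul_exp_sq μ t v hv ht]
    rw [integral_const_mul, integral_gaussianPDFReal_eq_one _ hv', mul_one]
    have h1 : (√(1 - 2 * t * v))⁻¹ ≤ Real.exp (t * v / (1 - 2 * t * v)) := by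
      have := Real.one_sub_inv_le_log_of_pos hq
      rw [← Real.exp_log (inv_pos.2 (Real.sqrt_pos.2 hq)), Real.exp_le_exp, Real.log_inv,
        Real.log_sqrt hq.le]
      have h3 : 1 - (1 - 2 * t * v)⁻¹ = - 2 * (t * v / (1 - 2 * t * v)) := by
        field_simp
        ring
      linarith
    calc _ ≤ Real.exp (t * v / (1 - 2 * t * v)) * Real.exp (t * μ ^ 2 / (1 - 2 * t * v)) := by
          gcongr
      _ = _ := by
          rw [← Real.exp_add]; congr 1; ring

section Concentration

variable {m n : ℕ}

lemma hasLaw_mulVec_add_apply (v : ℝ≥0) (f : Fin n → ℝ) (e : Fin m → ℝ) (i : Fin m) :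
    HasLaw (fun B : Fin m → Fin n → ℝ => ∑ j, B i j * f j + e i)
      (gaussianReal (e i) (∑ j, .mk (f j ^ 2) (sq_nonneg _) * v))
      (Measure.pi fun _ => Measure.pi fun _ => gaussianReal 0 v) := by
  have h1 : HasLaw (fun r : Fin n → ℝ => ∑ j, r j * f j)
      (gaussianReal 0 (∑ j, .mk (f j ^ 2) (sq_nonneg _) * v))
      (Measure.pi fun _ => gaussianReal 0 v) := by
    have hind : iIndepFun (fun (j : Fin n) (r : Fin n → ℝ) => r j * f j)
        (Measure.pi fun _ => gaussianReal 0 v) :=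
      iIndepFun_pi (X := fun j (x : ℝ) => x * f j) (fun j => by fun_prop)
    have := hasLaw_sum_gaussianReal hind
      (v := fun j => .mk (f j ^ 2) (sq_nonneg _) * v) (fun j => ?_) Finset.univ
    · convert this using 1
      ext r
      simp
    · have h := gaussianReal_mul_const
        (measurePreserving_eval (fun _ : Fin n => gaussianReal 0 v) j).hasLaw (f j)
      simpa using h
  have h2 := (gaussianReal_add_const h1 (e i)).comp
    (measurePreserving_eval (fun _ : Fin m => Measure.pi fun _ : Fin n => gaussianReal 0 v) i).hasLaw
  simpa [Function.comp_def] using h2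

lemma mgf_sum_sq_gaussian_le (v : ℝ≥0) (f : Fin n → ℝ) (e : Fin m → ℝ) (t : ℝ)
    (ht : 2 * t * ((∑ j, f j ^ 2) * v) < 1) :
    Integrable (fun B : Fin m → Fin n → ℝ =>
        Real.exp (t * ∑ i, (∑ j, B i j * f j + e i) ^ 2))
      (Measure.pi fun _ => Measure.pi fun _ => gaussianReal 0 v) ∧
    mgf (fun B : Fin m → Fin n → ℝ => ∑ i, (∑ j, B i j * f j + e i) ^ 2)
      (Measure.pi fun _ => Measure.pi fun _ => gaussianReal 0 v) t ≤
      Real.exp (t * (∑ i, e i ^ 2 + m * ((∑ j, f j ^ 2) * v)) /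
        (1 - 2 * t * ((∑ j, f j ^ 2) * v))) := by
  set ν : Measure (Fin m → Fin n → ℝ) := Measure.pi fun _ => Measure.pi fun _ => gaussianReal 0 v
  set w : ℝ≥0 := ∑ j, .mk (f j ^ 2) (sq_nonneg _) * v with hw
  have hwv : (∑ j, f j ^ 2) * (v : ℝ) = w := by
    simp [hw, Finset.sum_mul]
  rw [hwv] at ht ⊢
  have hlaw : ∀ i, HasLaw (fun B : Fin m → Fin n → ℝ => ∑ j, B i j * f j + e i)
      (gaussianReal (e i) w) ν := fun i => hasLaw_mulVec_add_apply v f e i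
  have hind : iIndepFun (fun (i : Fin m) (B : Fin m → Fin n → ℝ) =>
      (∑ j, B i j * f j + e i) ^ 2) ν :=
    iIndepFun_pi (X := fun i (r : Fin n → ℝ) => (∑ j, r j * f j + e i) ^ 2)
      (fun i => Measurable.aemeasurable (by fun_prop))
  have hmeas : ∀ i, Measurable fun B : Fin m → Fin n → ℝ => (∑ j, B i j * f j + e i) ^ 2 := by
    intro i; fun_prop
  have hint : ∀ i, Integrable (fun B : Fin m → Fin n → ℝ =>
      Real.exp (t * (∑ j, B i j * f j + e i) ^ 2)) ν := by
    intro i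
    have h := integrable_exp_mul_sq_gaussianReal (e i) t w ht
    rw [← (hlaw i).map_eq] at h
    exact h.comp_aemeasurable (hlaw i).aemeasurable
  have hmgf : ∀ i, mgf (fun B : Fin m → Fin n → ℝ => (∑ j, B i j * f j + e i) ^ 2) ν t ≤
      Real.exp (t * (e i ^ 2 + w) / (1 - 2 * t * w)) := by
    intro i
    refine le_trans (le_of_eq ?_) (mgf_sq_gaussianReal_le (e i) t w ht)
    exact (hlaw i).integral_comp (f := fun x => Real.exp (t * x ^ 2))
      (by fun_prop)
  have hsum : (fun B : Fin m → Fin n → ℝ => ∑ i, (∑ j, B i j * f j + e i) ^ 2) =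
      ∑ i, fun B : Fin m → Fin n → ℝ => (∑ j, B i j * f j + e i) ^ 2 := by
    ext B; simp
  constructor
  · have := hind.integrable_exp_mul_sum hmeas (t := t) (s := Finset.univ) (fun i _ => hint i)
    simpa using this
  · rw [hsum, hind.mgf_sum hmeas]
    refine (Finset.prod_le_prod (fun _ _ => mgf_nonneg) (fun i _ => hmgf i)).trans ?_
    rw [← Real.exp_sum, ← Finset.sum_div, ← Finset.mul_sum, Finset.sum_add_distrib]
    simp

/-- Concentration of `‖B f + e‖²` around `‖f‖² + ‖e‖²` up to constant factors. -/
lemma measureReal_sum_sq_gaussian_le (hm : 0 < m) (f : Fin n → ℝ) (e : Fin m → ℝ)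
    (hN : 0 < ∑ j, f j ^ 2 + ∑ i, e i ^ 2) :
    (Measure.pi fun _ => Measure.pi fun _ => gaussianReal 0 (1 / (m : ℝ≥0))).real
      {B : Fin m → Fin n → ℝ | ¬ ((∑ j, f j ^ 2 + ∑ i, e i ^ 2) / 4 <
          ∑ i, (∑ j, B i j * f j + e i) ^ 2 ∧
        ∑ i, (∑ j, B i j * f j + e i) ^ 2 < 4 * (∑ j, f j ^ 2 + ∑ i, e i ^ 2))} ≤
      2 * Real.exp (-(m / 12 : ℝ)) := by
  have hm' : (0 : ℝ) < m := by exact_mod_cast hm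
  have ha : 0 ≤ ∑ j, f j ^ 2 := Finset.sum_nonneg fun _ _ => sq_nonneg _
  have hb : 0 ≤ ∑ i, e i ^ 2 := Finset.sum_nonneg fun _ _ => sq_nonneg _
  -- Write `N = ‖f‖² + ‖e‖²`. Taking `t = m / (4 N)` gives upper-tail exponent at most `-m + m/2`;
  -- taking `t = -m / N` gives lower-tail exponent at most `m/4 - m/3 = -m/12`, the weaker of the
  -- two.
  have hupper := mgf_sum_sq_gaussian_le (1 / (m : ℝ≥0)) f e
    (m / (4 * (∑ j, f j ^ 2 + ∑ i, e i ^ 2)))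
  have hlower := mgf_sum_sq_gaussian_le (1 / (m : ℝ≥0)) f e
    (- (m / (∑ j, f j ^ 2 + ∑ i, e i ^ 2)))
  set ν : Measure (Fin m → Fin n → ℝ) :=
    Measure.pi fun _ => Measure.pi fun _ => gaussianReal 0 (1 / (m : ℝ≥0))
  set a := ∑ j, f j ^ 2
  set b := ∑ i, e i ^ 2
  set Z : (Fin m → Fin n → ℝ) → ℝ := fun B => ∑ i, (∑ j, B i j * f j + e i) ^ 2
  have hv : ((1 / (m : ℝ≥0) : ℝ≥0) : ℝ) = 1 / m := by simp
  have e1 : 2 * (m / (4 * (a + b))) * (a * (1 / m : ℝ)) = a / (2 * (a + b)) := by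
    field_simp; ring
  have e2 : 2 * (-(m / (a + b))) * (a * (1 / m : ℝ)) = - (2 * a / (a + b)) := by
    field_simp
  have e3 : b + m * (a * (1 / m : ℝ)) = a + b := by field_simp; ring
  have i1 : a / (2 * (a + b)) ≤ 1 / 2 := by
    rw [div_le_div_iff₀ (by positivity) (by norm_num)]; linarith
  have i2 : 2 * a / (a + b) ≤ 2 := by
    rw [div_le_iff₀ hN]; linarith
  have i3 : 0 ≤ 2 * a / (a + b) := by positivity
  rw [hv, e1, e3] at hupper
  rw [hv, e2, e3] at hlower
  obtain ⟨hi1, hm1⟩ := hupper (by linarith)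
  obtain ⟨hi2, hm2⟩ := hlower (by linarith)
  have c1 := measure_ge_le_exp_mul_mgf (μ := ν) (X := Z) (4 * (a + b))
    (by positivity : 0 ≤ m / (4 * (a + b))) hi1
  have c2 := measure_le_le_exp_mul_mgf (μ := ν) (X := Z) ((a + b) / 4)
    (by rw [neg_nonpos]; positivity : - (m / (a + b)) ≤ 0) hi2
  have hexp1 : Real.exp (-(m / (4 * (a + b))) * (4 * (a + b))) *
      mgf Z ν (m / (4 * (a + b))) ≤ Real.exp (-(m / 12 : ℝ)) := by
    refine (mul_le_mul_of_nonneg_left hm1 (Real.exp_pos _).le).trans ?_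
    rw [← Real.exp_add, Real.exp_le_exp]
    have h1 : -(m / (4 * (a + b))) * (4 * (a + b)) = -m := by field_simp
    have h2 : m / (4 * (a + b)) * (a + b) = m / 4 := by field_simp
    have h3 : (m / 4 : ℝ) / (1 - a / (2 * (a + b))) ≤ m / 2 := by
      rw [div_le_iff₀ (by linarith)]
      nlinarith
    rw [h1, h2]
    linarith
  have hexp2 : Real.exp (- -(m / (a + b)) * ((a + b) / 4)) *
      mgf Z ν (-(m / (a + b))) ≤ Real.exp (-(m / 12 : ℝ)) := by
    refine (mul_le_mul_of_nonneg_left hm2 (Real.exp_pos _).le).trans ?_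
    rw [← Real.exp_add, Real.exp_le_exp]
    have h1 : - -(m / (a + b)) * ((a + b) / 4) = m / 4 := by field_simp
    have h2 : -(m / (a + b)) * (a + b) = -m := by field_simp
    have h3 : (m / 3 : ℝ) ≤ m / (1 - -(2 * a / (a + b))) :=
      div_le_div_of_nonneg_left hm'.le (by linarith) (by linarith)
    rw [h1, h2, neg_div]
    linarith
  calc ν.real {B | ¬ ((a + b) / 4 < Z B ∧ Z B < 4 * (a + b))}
      ≤ ν.real ({B | Z B ≤ (a + b) / 4} ∪ {B | 4 * (a + b) ≤ Z B}) := by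
        refine measureReal_mono ?_
        intro B hB
        simp only [Set.mem_ofPred_eq, not_and_or, not_lt] at hB
        exact hB
    _ ≤ _ := (measureReal_union_le _ _).trans (by linarith)

end Concentration

/-! ### Nets in finite-dimensional normed spaces -/

section Nets

variable {V F : Type*} [NormedAddCommGroup V] [NormedSpace ℝ V] [FiniteDimensional ℝ V]
  [NormedAddCommGroup F] [NormedSpace ℝ F]

open Module in
/-- The ball of radius `2` is covered by `5 ^ dim` balls of radius `1`. -/
lemma exists_unit_net (V : Type*) [NormedAddCommGroup V] [NormedSpace ℝ V]
    [FiniteDimensional ℝ V] :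
    ∃ N : Finset V, N.card ≤ 5 ^ finrank ℝ V ∧ ∀ x : V, ‖x‖ ≤ 2 → ∃ a ∈ N, ‖x - a‖ ≤ 1 := by
  classical
  -- A 1-separated subset of the ball of maximal size is a net; the volume bound on separated sets
  -- ensures that a maximum exists.
  let p : ℕ → Prop := fun k => ∃ N : Finset V, N.card = k ∧ (∀ c ∈ N, ‖c‖ ≤ 2) ∧
    ∀ c ∈ N, ∀ d ∈ N, c ≠ d → 1 ≤ ‖c - d‖
  have hp0 : p 0 := ⟨∅, by simp⟩
  obtain ⟨N, hcard, hN2, hsep⟩ := Nat.findGreatest_spec (Nat.zero_le (5 ^ finrank ℝ V)) hp0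
  refine ⟨N, Besicovitch.card_le_of_separated N hN2 hsep, fun x hx => ?_⟩
  by_contra! hcon
  have hxN : x ∉ N := fun hxN => by simpa using (hcon x hxN).trans_le' zero_le_one
  have hins : p (Nat.findGreatest p (5 ^ finrank ℝ V) + 1) := by
    refine ⟨insert x N, by rw [Finset.card_insert_of_notMem hxN, hcard], ?_, ?_⟩
    · simpa [hx] using hN2
    · intro c hc d hd hcd
      rcases Finset.mem_insert.1 hc with hc | hc <;> rcases Finset.mem_insert.1 hd with hd | hd
      · exact absurd (hc.trans hd.symm) hcd
      · rw [hc]; exact (hcon d hd).le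
      · rw [hd, norm_sub_rev]; exact (hcon c hc).le
      · exact hsep c hc d hd hcd
  obtain ⟨N', hN'⟩ := hins
  have hle : Nat.findGreatest p (5 ^ finrank ℝ V) + 1 ≤ 5 ^ finrank ℝ V := by
    rw [← hN'.1]
    exact Besicovitch.card_le_of_separated N' hN'.2.1 hN'.2.2
  exact absurd ⟨N', hN'⟩ (Nat.findGreatest_is_greatest (Nat.lt_succ_self _) hle)

open Module in
/-- The unit ball is covered by `125 ^ dim` balls of radius `1 / 8`. -/
lemma exists_eighth_net (V : Type*) [NormedAddCommGroup V] [NormedSpace ℝ V]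
    [FiniteDimensional ℝ V] :
    ∃ N : Finset V, N.card ≤ 125 ^ finrank ℝ V ∧
      ∀ x : V, ‖x‖ ≤ 1 → ∃ a ∈ N, ‖x - a‖ ≤ 1 / 8 := by
  classical
  obtain ⟨N, hcard, hN⟩ := exists_unit_net V
  -- Three rounds of approximation: the residual of each round is doubled and approximated again
  -- from `N`, whence `125 = 5 ^ 3`.
  refine ⟨(N ×ˢ N ×ˢ N).image fun q =>
    (1 / 2 : ℝ) • q.1 + (1 / 4 : ℝ) • q.2.1 + (1 / 8 : ℝ) • q.2.2, ?_, fun x hx => ?_⟩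
  · refine Finset.card_image_le.trans ?_
    rw [Finset.card_product, Finset.card_product]
    calc N.card * (N.card * N.card)
        ≤ 5 ^ finrank ℝ V * (5 ^ finrank ℝ V * 5 ^ finrank ℝ V) := by gcongr
      _ = 125 ^ finrank ℝ V := by rw [← mul_pow, ← mul_pow]; norm_num
  · have hdouble : ∀ y : V, ‖y‖ ≤ 1 → ‖(2 : ℝ) • y‖ ≤ 2 := fun y hy => by
      rw [norm_smul, Real.norm_ofNat]; linarith
    obtain ⟨a, ha, ha'⟩ := hN _ (hdouble x hx)
    obtain ⟨b, hb, hb'⟩ := hN _ (hdouble _ ha')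
    obtain ⟨c, hc, hc'⟩ := hN _ (hdouble _ hb')
    refine ⟨_, Finset.mem_image.2 ⟨(a, b, c), by simp [ha, hb, hc], rfl⟩, ?_⟩
    have : x - ((1 / 2 : ℝ) • a + (1 / 4 : ℝ) • b + (1 / 8 : ℝ) • c) =
        (1 / 8 : ℝ) • ((2 : ℝ) • ((2 : ℝ) • ((2 : ℝ) • x - a) - b) - c) := by
      module
    rw [this, norm_smul]
    norm_num
    linarith

/-- A linear map that is bounded above and below on a net is so everywhere. -/
lemma bounds_of_bounds_on_net (N : Finset V)
    (hN : ∀ x : V, ‖x‖ ≤ 1 → ∃ a ∈ N, ‖x - a‖ ≤ 1 / 8) (L : V →ₗ[ℝ] F)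
    (hL : ∀ a ∈ N, 1 / 2 * ‖a‖ ≤ ‖L a‖ ∧ ‖L a‖ ≤ 2 * ‖a‖) (x : V) :
    1 / 10 * ‖x‖ ≤ ‖L x‖ ∧ ‖L x‖ ≤ 3 * ‖x‖ := by
  set M := LinearMap.toContinuousLinearMap L with hM
  -- The upper bound is self-improving: `‖M‖ ≤ 9/4 + ‖M‖/8` forces `‖M‖ ≤ 18/7`, and then `7/16 -
  -- ‖M‖/8` exceeds `1/10`.
  have hunit : ∀ y : V, ‖y‖ = 1 →
      ‖L y‖ ≤ 9 / 4 + ‖M‖ / 8 ∧ 7 / 16 - ‖M‖ / 8 ≤ ‖L y‖ := by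
    intro y hy
    obtain ⟨a, ha, hya⟩ := hN y hy.le
    have h1 : ‖L (y - a)‖ ≤ ‖M‖ / 8 := by
      have := M.le_opNorm (y - a)
      have h2 := mul_le_mul_of_nonneg_left hya (norm_nonneg M)
      have h3 : M (y - a) = L (y - a) := rfl
      rw [h3] at this
      linarith
    have h4 : L y = L a + L (y - a) := by rw [← map_add]; simp
    have h5 : L a = L y - L (y - a) := by rw [h4]; simp
    have h6 : ‖L y‖ ≤ ‖L a‖ + ‖L (y - a)‖ := by rw [h4]; exact norm_add_le _ _
    have h7 : ‖L a‖ ≤ ‖L y‖ + ‖L (y - a)‖ := by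
      conv_lhs => rw [h5]
      exact norm_sub_le _ _
    have h8 : ‖a‖ ≤ ‖y‖ + ‖y - a‖ := by
      have := norm_sub_le y (y - a)
      simpa using this
    have h9 : ‖y‖ ≤ ‖a‖ + ‖y - a‖ := by
      have := norm_add_le a (y - a)
      simpa using this
    have := hL a ha
    constructor <;> linarith
  have hMle : ‖M‖ ≤ 18 / 7 := by
    have : ‖M‖ ≤ 9 / 4 + ‖M‖ / 8 :=
      ContinuousLinearMap.opNorm_le_of_unit_norm (by positivity) fun y hy => (hunit y hy).1
    linarith
  constructor
  · by_cases hx : x = 0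
    · simp [hx]
    have hx' : 0 < ‖x‖ := norm_pos_iff.2 hx
    have hu : ‖‖x‖⁻¹ • x‖ = 1 := by
      rw [norm_smul, norm_inv, norm_norm, inv_mul_cancel₀ hx'.ne']
    have h := (hunit _ hu).2
    rw [map_smul, norm_smul, norm_inv, norm_norm] at h
    have h2 : 1 / 10 ≤ ‖x‖⁻¹ * ‖L x‖ := by linarith
    rw [inv_mul_eq_div, le_div_iff₀ hx'] at h2
    exact h2
  · have := M.le_opNorm x
    have h3 : M x = L x := rfl
    rw [h3] at this
    nlinarith [norm_nonneg x]

end Nets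

/-! ### Norm inequalities and frames with `W Wᵀ = 1` -/

section Norms

variable {ι κ μ : Type*} [Fintype ι] [Fintype κ] [Fintype μ]

lemma l2Norm_nonneg (x : ι → ℝ) : 0 ≤ l2Norm x := norm_nonneg _

lemma l2Norm_zero : l2Norm (0 : ι → ℝ) = 0 := by simp [l2Norm]

lemma l2Norm_add_le (x y : ι → ℝ) : l2Norm (x + y) ≤ l2Norm x + l2Norm y := by
  simpa [l2Norm] using norm_add_le (WithLp.toLp 2 x) (WithLp.toLp 2 y)

lemma l2Norm_sub_le (x y : ι → ℝ) : l2Norm (x - y) ≤ l2Norm x + l2Norm y := by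
  simpa [l2Norm] using norm_sub_le (WithLp.toLp 2 x) (WithLp.toLp 2 y)

lemma l2Norm_sq (x : ι → ℝ) : l2Norm x ^ 2 = ∑ i, x i ^ 2 := by
  simp [l2Norm, EuclideanSpace.real_norm_sq_eq]

lemma l2Norm_sq_eq_dotProduct (x : ι → ℝ) : l2Norm x ^ 2 = x ⬝ᵥ x := by
  rw [l2Norm_sq, dotProduct]
  exact Finset.sum_congr rfl fun _ _ => sq _

lemma dotProduct_le_l2Norm_mul (x y : ι → ℝ) : x ⬝ᵥ y ≤ l2Norm x * l2Norm y := by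
  refine le_of_abs_le (abs_le_of_sq_le_sq ?_
    (mul_nonneg (l2Norm_nonneg x) (l2Norm_nonneg y)))
  rw [mul_pow, l2Norm_sq, l2Norm_sq]
  exact Finset.sum_mul_sq_le_sq_mul_sq _ _ _

lemma l1Norm_eq_sum (x : ι → ℝ) : l1Norm x = ∑ i, |x i| := by
  simp [l1Norm, PiLp.norm_eq_of_L1]

lemma dotProduct_le_l1Norm_mul (x y : ι → ℝ) : x ⬝ᵥ y ≤ l1Norm x * linftyNorm y := by
  rw [l1Norm_eq_sum, Finset.sum_mul, dotProduct]
  refine Finset.sum_le_sum fun i _ => (le_abs_self _).trans ?_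
  rw [abs_mul]
  exact mul_le_mul_of_nonneg_left (norm_le_pi_norm y i) (abs_nonneg _)

lemma dotProduct_transpose_mulVec [DecidableEq ι] {W : Matrix ι κ ℝ} (hW : W * Wᵀ = 1)
    (g h : ι → ℝ) : (Wᵀ *ᵥ g) ⬝ᵥ (Wᵀ *ᵥ h) = g ⬝ᵥ h := by
  rw [Matrix.dotProduct_mulVec, Matrix.vecMul_transpose, Matrix.mulVec_mulVec, hW,
    Matrix.one_mulVec]

lemma l2Norm_transpose_mulVec [DecidableEq ι] {W : Matrix ι κ ℝ} (hW : W * Wᵀ = 1) (h : ι → ℝ) :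
    l2Norm (Wᵀ *ᵥ h) = l2Norm h := by
  rw [← sq_eq_sq₀ (l2Norm_nonneg _) (l2Norm_nonneg _), l2Norm_sq_eq_dotProduct,
    l2Norm_sq_eq_dotProduct, dotProduct_transpose_mulVec hW]

/-- `Wᵀ` is an isometry, so its adjoint `W` is a contraction. -/
lemma l2Norm_mulVec_le [DecidableEq ι] {W : Matrix ι κ ℝ} (hW : W * Wᵀ = 1) (x : κ → ℝ) :
    l2Norm (W *ᵥ x) ≤ l2Norm x := by
  have h1 : l2Norm (W *ᵥ x) ^ 2 ≤ l2Norm x * l2Norm (W *ᵥ x) := by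
    rw [l2Norm_sq_eq_dotProduct, ← l2Norm_transpose_mulVec hW (W *ᵥ x),
      Matrix.dotProduct_mulVec, ← Matrix.mulVec_transpose, dotProduct_comm]
    exact dotProduct_le_l2Norm_mul _ _
  nlinarith [l2Norm_nonneg (W *ᵥ x), l2Norm_nonneg x]

end Norms

/-! ### From sparse vectors to all vectors -/

section Sparse

variable {ι κ μ : Type*} [DecidableEq ι]

/-- The restriction of a vector to a set of coordinates, extended by zero. -/
noncomputable def cut (S : Finset ι) (x : ι → ℝ) : ι → ℝ :=
  fun i => if i ∈ S then x i else 0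

lemma cut_add_cut_of_disjoint {S T : Finset ι} (h : Disjoint S T) (x : ι → ℝ) :
    cut (S ∪ T) x = cut S x + cut T x := by
  ext i
  have hi : i ∈ S → i ∉ T := fun hS => Finset.disjoint_left.1 h hS
  by_cases h1 : i ∈ S <;> by_cases h2 : i ∈ T <;> simp_all [cut]

/-- Every finite set contains a subset of prescribed size with the largest entries of `x`. -/
lemma exists_subset_largest (x : ι → ℝ) (S : Finset ι) (Q : ℕ) (hQ : Q ≤ S.card) :
    ∃ T ⊆ S, T.card = Q ∧ ∀ i ∈ T, ∀ j ∈ S \ T, |x j| ≤ |x i| := by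
  induction Q with
  | zero => exact ⟨∅, by simp⟩
  | succ Q ih =>
    obtain ⟨T, hTS, hcard, hT⟩ := ih (by omega)
    have hne : (S \ T).Nonempty := by
      rw [← Finset.card_pos, Finset.card_sdiff_of_subset hTS]
      omega
    obtain ⟨k, hk, hkmax⟩ := Finset.exists_max_image (S \ T) (fun i => |x i|) hne
    have hk' := Finset.mem_sdiff.1 hk
    refine ⟨insert k T, Finset.insert_subset hk'.1 hTS, ?_, ?_⟩
    · rw [Finset.card_insert_of_notMem hk'.2, hcard]
    · intro i hi j hj
      have hj' : j ∈ S \ T := by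
        simp only [Finset.mem_sdiff, Finset.mem_insert, not_or] at hj ⊢
        exact ⟨hj.1, hj.2.2⟩
      rcases Finset.mem_insert.1 hi with rfl | hi
      · exact hkmax j hj'
      · exact hT i hi j hj'

variable [Fintype ι] [Fintype κ] [Fintype μ] [DecidableEq κ]

lemma cut_add_cut_compl (S : Finset ι) (x : ι → ℝ) : cut S x + cut Sᶜ x = x := by
  ext i
  by_cases h1 : i ∈ S <;> simp [cut, h1]

lemma l2Norm_cut_sq (S : Finset ι) (x : ι → ℝ) : l2Norm (cut S x) ^ 2 = ∑ i ∈ S, x i ^ 2 := by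
  simp [l2Norm_sq, cut, ite_pow]

/-- Bound for a subadditive functional controlled on sparse vectors. -/
lemma subadditive_cut_le {p : (ι → ℝ) → ℝ} (hadd : ∀ x y, p (x + y) ≤ p x + p y) {Q : ℕ}
    (hQ : 0 < Q) {B : ℝ} (hB : 0 ≤ B)
    (hp : ∀ S : Finset ι, S.card ≤ Q → ∀ x, p (cut S x) ≤ B * l2Norm (cut S x)) (x : ι → ℝ)
    (S : Finset ι) (a : ℝ) (ha : 0 ≤ a) (hS : ∀ i ∈ S, |x i| ≤ a) :
    p (cut S x) ≤ B * (√Q * a + (∑ i ∈ S, |x i|) / √Q) := by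
  have hQ' : (0 : ℝ) < Q := by exact_mod_cast hQ
  have hsq : 0 < √(Q : ℝ) := Real.sqrt_pos.2 hQ'
  have hsmall : ∀ (T : Finset ι) (a : ℝ), 0 ≤ a → T.card ≤ Q → (∀ i ∈ T, |x i| ≤ a) →
      p (cut T x) ≤ B * (√Q * a) := by
    intro T a ha hT hTa
    refine (hp T hT x).trans (mul_le_mul_of_nonneg_left ?_ hB)
    rw [← sq_le_sq₀ (l2Norm_nonneg _) (by positivity), l2Norm_cut_sq, mul_pow,
      Real.sq_sqrt hQ'.le]
    calc ∑ i ∈ T, x i ^ 2 ≤ ∑ _i ∈ T, a ^ 2 := Finset.sum_le_sum fun i hi => by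
          rw [← sq_abs]; exact pow_le_pow_left₀ (abs_nonneg _) (hTa i hi) 2
      _ = T.card * a ^ 2 := by simp
      _ ≤ Q * a ^ 2 := by gcongr
  induction S using Finset.strongInduction generalizing a with
  | H S ih =>
    by_cases hcard : S.card ≤ Q
    · refine (hsmall S a ha hcard hS).trans (mul_le_mul_of_nonneg_left ?_ hB)
      have : 0 ≤ (∑ i ∈ S, |x i|) / √(Q : ℝ) := by positivity
      linarith
    -- Peel off the `Q` largest entries. The smallest of them, `|x k|`, bounds everything left, and
    -- `√Q |x k|` is paid for by the `ℓ¹` mass of the removed block.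
    · obtain ⟨T, hTS, hTcard, hT⟩ := exists_subset_largest x S Q (by omega)
      have hTne : T.Nonempty := by rw [← Finset.card_pos]; omega
      obtain ⟨k, hk, hkmin⟩ := Finset.exists_min_image T (fun i => |x i|) hTne
      have h1 := hsmall T a ha hTcard.le fun i hi => hS i (hTS hi)
      have h2 := ih (S \ T) (Finset.sdiff_ssubset hTS hTne) |x k| (abs_nonneg _)
        (fun j hj => hT k hk j hj)
      have h3 : √(Q : ℝ) * |x k| ≤ (∑ i ∈ T, |x i|) / √Q := by
        rw [le_div_iff₀ hsq, mul_right_comm, Real.mul_self_sqrt hQ'.le]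
        have := Finset.card_nsmul_le_sum T (fun i => |x i|) |x k| hkmin
        rwa [hTcard, nsmul_eq_mul] at this
      have h4 : cut S x = cut T x + cut (S \ T) x := by
        rw [← cut_add_cut_of_disjoint Finset.disjoint_sdiff, Finset.union_sdiff_of_subset hTS]
      have h5 : ∑ i ∈ S, |x i| = ∑ i ∈ S \ T, |x i| + ∑ i ∈ T, |x i| :=
        (Finset.sum_sdiff hTS).symm
      rw [h4, h5, add_div]
      refine (hadd _ _).trans ?_
      have := mul_le_mul_of_nonneg_left h3 hB
      linarith

/-- Off a suitable set of `Q` coordinates, every functional that is subadditive and bounded by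
`B ‖·‖₂` on `Q`-sparse vectors is at most `B ‖x‖₁ / √Q`. -/
lemma exists_sparse_head (x : ι → ℝ) {Q : ℕ} (hQ : 0 < Q) :
    ∃ T : Finset ι, T.card ≤ Q ∧ ∀ (p : (ι → ℝ) → ℝ) (B : ℝ),
      (∀ x y, p (x + y) ≤ p x + p y) → 0 ≤ B →
      (∀ S : Finset ι, S.card ≤ Q → ∀ x, p (cut S x) ≤ B * l2Norm (cut S x)) →
      p (cut Tᶜ x) ≤ B * (l1Norm x / √Q) := by
  have hQ' : (0 : ℝ) < Q := by exact_mod_cast hQ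
  have hsq : 0 < √(Q : ℝ) := Real.sqrt_pos.2 hQ'
  obtain ⟨T, hTcard, a, ha, hTa, haT⟩ : ∃ T : Finset ι, T.card ≤ Q ∧ ∃ a : ℝ, 0 ≤ a ∧
      (∀ i ∈ Tᶜ, |x i| ≤ a) ∧ √Q * a ≤ (∑ i ∈ T, |x i|) / √Q := by
    by_cases hcard : (Finset.univ : Finset ι).card ≤ Q
    · exact ⟨Finset.univ, hcard, 0, le_rfl, by simp, by
        rw [mul_zero]; positivity⟩
    · obtain ⟨T, -, hTcard, hT⟩ := exists_subset_largest x Finset.univ Q (by omega)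
      have hTne : T.Nonempty := by rw [← Finset.card_pos]; omega
      obtain ⟨k, hk, hkmin⟩ := Finset.exists_min_image T (fun i => |x i|) hTne
      refine ⟨T, hTcard.le, |x k|, abs_nonneg _, fun j hj => hT k hk j ?_, ?_⟩
      · simpa using hj
      · rw [le_div_iff₀ hsq, mul_right_comm, Real.mul_self_sqrt hQ'.le]
        have := Finset.card_nsmul_le_sum T (fun i => |x i|) |x k| hkmin
        rwa [hTcard, nsmul_eq_mul] at this
  refine ⟨T, hTcard, fun p B hadd hB hp => ?_⟩
  refine (subadditive_cut_le hadd hQ hB hp x Tᶜ a ha hTa).trans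
    (mul_le_mul_of_nonneg_left ?_ hB)
  rw [l1Norm_eq_sum, ← Finset.sum_add_sum_compl T, add_div]
  linarith

/-- Near-isometry on sparse vectors in a tight frame yields a lower bound for all vectors. -/
lemma l2Norm_le_of_sparse_bounds {Φ : Matrix μ ι ℝ} {W : Matrix ι κ ℝ} (hW : W * Wᵀ = 1)
    {Q : ℕ} (hQ : 0 < Q)
    (hΦ : ∀ S : Finset κ, S.card ≤ Q → ∀ x,
      1 / 10 * l2Norm (W *ᵥ cut S x) ≤ l2Norm (Φ *ᵥ (W *ᵥ cut S x)) ∧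
      l2Norm (Φ *ᵥ (W *ᵥ cut S x)) ≤ 3 * l2Norm (W *ᵥ cut S x)) (h : ι → ℝ) :
    1 / 10 * l2Norm h ≤ l2Norm (Φ *ᵥ h) + 4 * (l1Norm (Wᵀ *ᵥ h) / √Q) := by
  obtain ⟨T, hT, htail⟩ := exists_sparse_head (Wᵀ *ᵥ h) hQ
  -- The head `T` does not depend on the functional, so one splitting bounds both the tail and its
  -- image under `Φ`.
  have h1 := htail (fun x => l2Norm (W *ᵥ x)) 1
    (fun x y => by rw [Matrix.mulVec_add]; exact l2Norm_add_le _ _) zero_le_one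
    (fun S _ x => by rw [one_mul]; exact l2Norm_mulVec_le hW _)
  have h2 := htail (fun x => l2Norm (Φ *ᵥ (W *ᵥ x))) 3
    (fun x y => by rw [Matrix.mulVec_add, Matrix.mulVec_add]; exact l2Norm_add_le _ _)
    (by norm_num)
    (fun S hS x => (hΦ S hS x).2.trans
      (mul_le_mul_of_nonneg_left (l2Norm_mulVec_le hW _) (by norm_num)))
  have h3 := (hΦ T hT (Wᵀ *ᵥ h)).1
  have hdec : h = W *ᵥ cut T (Wᵀ *ᵥ h) + W *ᵥ cut Tᶜ (Wᵀ *ᵥ h) := by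
    rw [← Matrix.mulVec_add, cut_add_cut_compl, Matrix.mulVec_mulVec, hW, Matrix.one_mulVec]
  set head := W *ᵥ cut T (Wᵀ *ᵥ h)
  set tail := W *ᵥ cut Tᶜ (Wᵀ *ᵥ h)
  have h4 : l2Norm h ≤ l2Norm head + l2Norm tail := by
    conv_lhs => rw [hdec]
    exact l2Norm_add_le _ _
  have h5 : l2Norm (Φ *ᵥ head) ≤ l2Norm (Φ *ᵥ h) + l2Norm (Φ *ᵥ tail) := by
    have : Φ *ᵥ head = Φ *ᵥ h - Φ *ᵥ tail := by
      rw [← Matrix.mulVec_sub]; congr 1; exact (sub_eq_of_eq_add hdec).symm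
    rw [this]
    exact l2Norm_sub_le _ _
  have h6 : 0 ≤ l1Norm (Wᵀ *ᵥ h) / √(Q : ℝ) := div_nonneg (norm_nonneg _) (Real.sqrt_nonneg _)
  linarith

open Module in
/-- A finite set of vectors on which a matrix has to be tested in order to be well conditioned
on all `Q`-sparse combinations of the columns of `W`. -/
lemma exists_test_vectors (W : Matrix ι κ ℝ) (Q : ℕ) :
    ∃ N : Finset (ι → ℝ), N.card ≤ (Fintype.card κ).choose (min Q (Fintype.card κ)) * 125 ^ Q ∧
      ∀ Φ : Matrix μ ι ℝ,
        (∀ a ∈ N, 1 / 2 * l2Norm a ≤ l2Norm (Φ *ᵥ a) ∧ l2Norm (Φ *ᵥ a) ≤ 2 * l2Norm a) →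
        ∀ S : Finset κ, S.card ≤ Q → ∀ x,
          1 / 10 * l2Norm (W *ᵥ cut S x) ≤ l2Norm (Φ *ᵥ (W *ᵥ cut S x)) ∧
          l2Norm (Φ *ᵥ (W *ᵥ cut S x)) ≤ 3 * l2Norm (W *ᵥ cut S x) := by
  classical
  let V : Finset κ → Submodule ℝ (EuclideanSpace ℝ ι) := fun T =>
    Submodule.span ℝ (Set.range fun t : T => WithLp.toLp 2 (W.col t))
  choose N hNcard hNnet using fun T => exists_eighth_net (V T)
  refine ⟨(Finset.powersetCard (min Q (Fintype.card κ)) Finset.univ).biUnion fun T =>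
    (N T).image fun a : V T => WithLp.ofLp a.1, ?_, ?_⟩
  · refine (Finset.card_biUnion_le_card_mul _ _ (125 ^ Q) fun T hT => ?_).trans ?_
    · refine Finset.card_image_le.trans ((hNcard T).trans ?_)
      refine Nat.pow_le_pow_right (by norm_num) ?_
      have h1 : finrank ℝ (V T) ≤ Fintype.card T := finrank_range_le_card _
      rw [Fintype.card_coe, (Finset.mem_powersetCard.1 hT).2] at h1
      exact h1.trans (min_le_left _ _)
    · rw [Finset.card_powersetCard, Finset.card_univ]
  · intro Φ hΦ S hS x
    -- Enlarging the support to a fixed size lets a single binomial coefficient count the subspaces.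
    obtain ⟨T, hST, hT⟩ := Finset.exists_superset_card_eq (s := S)
      (n := min Q (Fintype.card κ)) (le_min hS (Finset.card_le_univ S)) (min_le_right _ _)
    have hmem : WithLp.toLp 2 (W *ᵥ cut S x) ∈ V T := by
      rw [Matrix.mulVec_eq_sum, WithLp.toLp_sum]
      refine Submodule.sum_mem _ fun k _ => ?_
      by_cases hk : k ∈ S
      · rw [op_smul_eq_smul, WithLp.toLp_smul]
        exact Submodule.smul_mem _ _ (Submodule.subset_span ⟨⟨k, hST hk⟩, rfl⟩)
      · simp [cut, hk]
    exact bounds_of_bounds_on_net (N T) (hNnet T)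
      ((Matrix.toLpLin 2 2 Φ).domRestrict (V T))
      (fun a ha => hΦ _ (Finset.mem_biUnion.2
        ⟨T, by simp [Finset.mem_powersetCard, hT], Finset.mem_image_of_mem _ ha⟩))
      ⟨_, hmem⟩

end Sparse

/-- With `Q = q L ≤ N`, the binomial coefficient is at most `(e N / Q)^Q ≤ (N / L)^Q` because `q ≥ 3
> e`; and `125 ≤ 2 ^ 7 ≤ (N / L) ^ 7`. Together these give the factor 8. -/
lemma choose_mul_pow_le_exp {N L q : ℕ} (hq : 3 ≤ q) (hL : 0 < L) (hN : 2 * L ≤ N) :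
    (((N.choose (min (q * L) N) * 125 ^ (q * L) : ℕ)) : ℝ) ≤
      Real.exp (8 * (q * L) * Real.log (N / L)) := by
  have hL' : (0 : ℝ) < L := by exact_mod_cast hL
  have hq' : (3 : ℝ) ≤ q := by exact_mod_cast hq
  have hr : (2 : ℝ) ≤ (N : ℝ) / L := by
    rw [le_div_iff₀ hL']; exact_mod_cast hN
  have hr0 : (0 : ℝ) < (N : ℝ) / L := by linarith
  have hchoose : ((N.choose (min (q * L) N) : ℕ) : ℝ) ≤ ((N : ℝ) / L) ^ (q * L) := by
    rcases le_total (q * L) N with h | h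
    · rw [min_eq_left h]
      have h1 : ((q * L : ℕ) : ℝ) ^ (q * L) / (q * L).factorial ≤ Real.exp ((q * L : ℕ) : ℝ) :=
        Real.pow_div_factorial_le_exp _ (by positivity) _
      have hQ : (0 : ℝ) < ((q * L : ℕ) : ℝ) := by push_cast; positivity
      have h2 : Real.exp ((q * L : ℕ) : ℝ) ≤ (q : ℝ) ^ (q * L) := by
        rw [← mul_one ((q * L : ℕ) : ℝ), Real.exp_nat_mul]
        exact pow_le_pow_left₀ (Real.exp_pos _).le (Real.exp_one_lt_three.le.trans hq') _
      calc ((N.choose (q * L) : ℕ) : ℝ) ≤ (N : ℝ) ^ (q * L) / (q * L).factorial :=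
            Nat.choose_le_pow_div _ _
        _ = ((N : ℝ) / ((q * L : ℕ) : ℝ)) ^ (q * L) *
            (((q * L : ℕ) : ℝ) ^ (q * L) / (q * L).factorial) := by
            rw [div_pow]; field_simp
        _ ≤ ((N : ℝ) / ((q * L : ℕ) : ℝ)) ^ (q * L) * (q : ℝ) ^ (q * L) := by
            gcongr; exact h1.trans h2
        _ = ((N : ℝ) / L) ^ (q * L) := by
            rw [← mul_pow]; congr 1; push_cast; field_simp
    · rw [min_eq_right h, Nat.choose_self, Nat.cast_one]
      exact one_le_pow₀ (by linarith)
  have h125 : (125 : ℝ) ≤ ((N : ℝ) / L) ^ 7 := by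
    have := pow_le_pow_left₀ (by norm_num : (0 : ℝ) ≤ 2) hr 7
    norm_num at this ⊢
    linarith
  have hexp : Real.exp (8 * (q * L) * Real.log (N / L)) =
      ((N : ℝ) / L) ^ (q * L) * (((N : ℝ) / L) ^ 7) ^ (q * L) := by
    rw [← pow_mul, ← pow_add, ← Real.exp_log hr0, ← Real.exp_nat_mul, Real.log_exp]
    congr 1; push_cast; ring
  rw [hexp]
  push_cast
  gcongr

/-! ### The good event -/

section Event

variable {S : Type*} [MeasurableSpace S] {P : Measure S} [IsProbabilityMeasure P] {m n : ℕ}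
  {A : S → Matrix (Fin m) (Fin n) ℝ}

lemma measureReal_phi_mulVec_le (hm : 0 < m) (hA : IsGaussianMatrix A P)
    (a : Fin n ⊕ Fin m → ℝ) :
    P.real {ω | ¬ (1 / 2 * l2Norm a ≤ l2Norm (phi (A ω) *ᵥ a) ∧
      l2Norm (phi (A ω) *ᵥ a) ≤ 2 * l2Norm a)} ≤ 2 * Real.exp (-(m / 12 : ℝ)) := by
  have hsq : l2Norm a ^ 2 = ∑ j, a (Sum.inl j) ^ 2 + ∑ i, a (Sum.inr i) ^ 2 := by
    rw [l2Norm_sq, Fintype.sum_sum_type]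
  rcases (l2Norm_nonneg a).eq_or_lt with h0 | h0
  · have ha : a = 0 := by
      have : WithLp.toLp 2 a = 0 := norm_eq_zero.1 h0.symm
      simpa using this
    have : ∀ ω, phi (A ω) *ᵥ a = 0 := fun ω => by rw [ha, Matrix.mulVec_zero]
    simp only [this, ← h0, l2Norm_zero]
    simp
    positivity
  · have hpos : 0 < ∑ j, a (Sum.inl j) ^ 2 + ∑ i, a (Sum.inr i) ^ 2 := by
      rw [← hsq]; positivity
    have hconc := measureReal_sum_sq_gaussian_le hm (fun j => a (Sum.inl j))
      (fun i => a (Sum.inr i)) hpos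
    rw [← map_matrix_eq_pi hA.1 hA.2] at hconc
    refine le_trans ?_ hconc
    have hmeas : AEMeasurable (fun ω i j => A ω i j) P :=
      aemeasurable_pi_lambda _ fun i => aemeasurable_pi_lambda _ fun j => (hA.1 i j).aemeasurable
    have := Measure.isProbabilityMeasure_map hmeas
    -- This inequality for the image measure needs no measurability of the set.
    refine le_trans (measureReal_mono ?_) (ENNReal.toReal_mono (measure_ne_top _ _)
      (Measure.le_map_apply hmeas _))
    intro ω hω
    simp only [Set.mem_preimage, Set.mem_ofPred_eq] at hω ⊢
    contrapose! hω
    have hphi : l2Norm (phi (A ω) *ᵥ a) ^ 2 =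
        ∑ i, (∑ j, A ω i j * a (Sum.inl j) + a (Sum.inr i)) ^ 2 := by
      rw [l2Norm_sq]
      refine Finset.sum_congr rfl fun i _ => ?_
      simp [phi, Matrix.mulVec, dotProduct, Fintype.sum_sum_type, Matrix.one_apply]
    rw [← hphi, ← hsq] at hω
    constructor
    · refine le_of_sq_le_sq ?_ (l2Norm_nonneg _)
      linarith
    · refine le_of_sq_le_sq ?_ (by positivity)
      linarith

lemma exists_event_phi_mulVec (hm : 0 < m) (hA : IsGaussianMatrix A P)
    (N : Finset (Fin n ⊕ Fin m → ℝ)) :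
    ∃ E : Set S, MeasurableSet E ∧ 1 - N.card * (2 * Real.exp (-(m / 12 : ℝ))) ≤ P.real E ∧
      ∀ ω ∈ E, ∀ a ∈ N, 1 / 2 * l2Norm a ≤ l2Norm (phi (A ω) *ᵥ a) ∧
        l2Norm (phi (A ω) *ᵥ a) ≤ 2 * l2Norm a := by
  set bad : (Fin n ⊕ Fin m → ℝ) → Set S := fun a =>
    {ω | ¬ (1 / 2 * l2Norm a ≤ l2Norm (phi (A ω) *ᵥ a) ∧
      l2Norm (phi (A ω) *ᵥ a) ≤ 2 * l2Norm a)}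
  -- A measurable hull of the bad set has the same measure, so its complement is a measurable good
  -- event.
  refine ⟨(toMeasurable P (⋃ a ∈ N, bad a))ᶜ, (measurableSet_toMeasurable _ _).compl, ?_, ?_⟩
  · rw [probReal_compl_eq_one_sub (measurableSet_toMeasurable _ _)]
    have h1 : P.real (toMeasurable P (⋃ a ∈ N, bad a)) = P.real (⋃ a ∈ N, bad a) := by
      simp [Measure.real, measure_toMeasurable]
    have h2 : P.real (⋃ a ∈ N, bad a) ≤ N.card * (2 * Real.exp (-(m / 12 : ℝ))) := by
      refine (measureReal_biUnion_finset_le _ _).trans ?_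
      refine (Finset.sum_le_sum fun a _ => measureReal_phi_mulVec_le hm hA a).trans ?_
      simp
    linarith
  · intro ω hω a ha
    by_contra hcon
    exact hω (subset_toMeasurable _ _ (Set.mem_biUnion ha hcon))

end Event

/-! ### Deterministic estimates in the cone -/

section Recovery

variable {ι κ μ : Type*} [Fintype ι] [Fintype κ] [Fintype μ]

/-- Vectors in the cone determined by a nearly sparse vector have small `ℓ¹` norm. -/
lemma l1Norm_le_of_cone [DecidableEq κ] (x w : κ → ℝ) (T : Finset κ) {K R : ℝ} (hT : T.card ≤ K)
    (hR : ∑ i ∈ Tᶜ, |x i| ≤ R) (hcone : l1Norm (x + w) ≤ l1Norm x + 1 / 2 * l1Norm w) :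
    l1Norm w ≤ 4 * √K * l2Norm w + 4 * R := by
  have hCS : ∑ i ∈ T, |w i| ≤ √K * l2Norm w := by
    have hK0 : 0 ≤ K := le_trans (by positivity) hT
    refine le_of_sq_le_sq ?_ (mul_nonneg (Real.sqrt_nonneg _) (l2Norm_nonneg _))
    rw [mul_pow, Real.sq_sqrt hK0]
    calc (∑ i ∈ T, |w i|) ^ 2 ≤ T.card * ∑ i ∈ T, |w i| ^ 2 := sq_sum_le_card_mul_sum_sq
      _ ≤ K * l2Norm w ^ 2 := by
        rw [l2Norm_sq]
        simp only [sq_abs]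
        exact mul_le_mul hT (Finset.sum_le_univ_sum_of_nonneg fun i => sq_nonneg (w i))
          (Finset.sum_nonneg fun i _ => sq_nonneg (w i)) hK0
  have hadd : ∀ z : κ → ℝ, l1Norm z = ∑ i ∈ T, |z i| + ∑ i ∈ Tᶜ, |z i| := fun z => by
    rw [l1Norm_eq_sum, Finset.sum_add_sum_compl]
  have h1 : ∑ i ∈ T, |x i| - ∑ i ∈ T, |w i| ≤ ∑ i ∈ T, |(x + w) i| := by
    rw [← Finset.sum_sub_distrib]
    refine Finset.sum_le_sum fun i _ => ?_
    have := abs_sub_abs_le_abs_sub (x i) (- w i)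
    simpa using this
  have h2 : ∑ i ∈ Tᶜ, |w i| - ∑ i ∈ Tᶜ, |x i| ≤ ∑ i ∈ Tᶜ, |(x + w) i| := by
    rw [← Finset.sum_sub_distrib]
    refine Finset.sum_le_sum fun i _ => ?_
    have := abs_sub_abs_le_abs_sub (w i) (- x i)
    simpa [add_comm] using this
  rw [hadd (x + w), hadd x, hadd w] at hcone
  rw [hadd w]
  linarith

/-- Stability in the cone of nearly sparse vectors. -/
lemma l2Norm_le_of_cone {Φ : Matrix μ ι ℝ} {W : Matrix ι κ ℝ} {L : ℕ}
    (hstab : ∀ h, 1 / 10 * l2Norm h ≤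
      l2Norm (Φ *ᵥ h) + 4 * (l1Norm (Wᵀ *ᵥ h) / √((102400 * L : ℕ) : ℝ)))
    {K R : ℝ} (hK : 0 < K) (hKL : K ≤ L) {h : ι → ℝ}
    (hl1 : l1Norm (Wᵀ *ᵥ h) ≤ 4 * √K * l2Norm h + 4 * R) :
    l2Norm h ≤ 20 * l2Norm (Φ *ᵥ h) + R / √K := by
  have hsK : 0 < √K := Real.sqrt_pos.2 hK
  -- The choice `102400 = 320 ^ 2` makes the `ℓ¹` term contribute `‖h‖₂ / 20`, half of the left side
  -- of `hstab`.
  have hs : √((102400 * L : ℕ) : ℝ) = 320 * √(L : ℝ) := by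
    push_cast
    rw [Real.sqrt_mul (by norm_num)]
    congr 1
    rw [show (102400 : ℝ) = 320 ^ 2 by norm_num, Real.sqrt_sq (by norm_num)]
  have hsKL : √K ≤ √(L : ℝ) := Real.sqrt_le_sqrt hKL
  have h1 := hstab h
  rw [hs] at h1
  have h2 : l1Norm (Wᵀ *ᵥ h) / (320 * √(L : ℝ)) ≤ (l2Norm h + R / √K) / 80 := by
    calc l1Norm (Wᵀ *ᵥ h) / (320 * √(L : ℝ)) ≤ l1Norm (Wᵀ *ᵥ h) / (320 * √K) := by
          gcongr
          exact norm_nonneg _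
      _ ≤ (4 * √K * l2Norm h + 4 * R) / (320 * √K) := by gcongr
      _ = _ := by field_simp; ring
  linarith

/-- Unless `H ≤ 2 r`, the terms in `r` are absorbed into `H`, leaving `H² ≤ 1600 · 18 t H`. -/
lemma le_add_of_sq_le {H Φh t r : ℝ} (ht : 0 ≤ t) (hr : 0 ≤ r) (hH : 0 ≤ H)
    (h1 : H ≤ 20 * Φh + r) (h2 : Φh ^ 2 ≤ 12 * t * (H + r)) : H ≤ 28800 * t + 2 * r := by
  by_cases hHr : H ≤ 2 * r
  · linarith
  · push Not at hHr
    have h3 : H ≤ 40 * Φh := by linarith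
    have h4 : H ^ 2 ≤ 1600 * Φh ^ 2 := by nlinarith
    have h5 : Φh ^ 2 ≤ 18 * t * H := by nlinarith
    have h6 : H * H ≤ (28800 * t) * H := by nlinarith
    have : H ≤ 28800 * t := le_of_mul_le_mul_right h6 (by linarith)
    linarith

end Recovery

/-! ### Block frame and best `k`-term approximation -/

section Frames

variable {n d m M : ℕ}

lemma mul_transpose_of_isTightFrame {D : Matrix (Fin n) (Fin d) ℝ} (hD : IsTightFrame D) :
    D * Dᵀ = 1 := by
  refine Matrix.toLin'.injective (LinearMap.ext fun f => ?_)
  simp only [Matrix.toLin'_apply, Matrix.one_mulVec]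
  conv_rhs => rw [hD f]
  rw [← Matrix.mulVec_mulVec, Matrix.mulVec_eq_sum]
  refine Finset.sum_congr rfl fun k _ => ?_
  rw [op_smul_eq_smul, dotProduct_comm]
  rfl

lemma blockFrame_mul_transpose {D : Matrix (Fin n) (Fin d) ℝ} {Ω : Matrix (Fin m) (Fin M) ℝ}
    (hD : IsTightFrame D) (hΩ : IsTightFrame Ω) :
    blockFrame D Ω * (blockFrame D Ω)ᵀ = 1 := by
  simp [blockFrame, Matrix.fromBlocks_transpose, Matrix.fromBlocks_multiply,
    mul_transpose_of_isTightFrame hD, mul_transpose_of_isTightFrame hΩ, Matrix.fromBlocks_one]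

lemma l2Norm_inl_sub_le (û : Fin n ⊕ Fin m → ℝ) (f : Fin n → ℝ) (e : Fin m → ℝ) :
    l2Norm (û ∘ Sum.inl - f) ≤ l2Norm (û - Sum.elim f e) := by
  rw [← sq_le_sq₀ (l2Norm_nonneg _) (l2Norm_nonneg _), l2Norm_sq, l2Norm_sq,
    Fintype.sum_sum_type]
  simp only [Pi.sub_apply, Function.comp_apply, Sum.elim_inl]
  exact le_add_of_nonneg_right (Finset.sum_nonneg fun _ _ => sq_nonneg _)

/-- The coordinates kept by `largest k x`. -/
noncomputable def largestSupport (k : ℕ) (x : Fin d → ℝ) : Finset (Fin d) :=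
  Finset.univ.filter fun i => (Finset.univ.filter fun j : Fin d =>
      |x i| < |x j| ∨ (|x j| = |x i| ∧ j < i)).card < k

/-- Breaking ties by index gives a strict total order, so ranks are distinct and at most `k` of them
lie below `k`. -/
lemma card_largestSupport_le (k : ℕ) (x : Fin d → ℝ) : (largestSupport k x).card ≤ k := by
  set rank : Fin d → ℕ := fun i => (Finset.univ.filter fun j : Fin d =>
      |x i| < |x j| ∨ (|x j| = |x i| ∧ j < i)).card with hrank
  have hlt : ∀ i j, (|x i| < |x j| ∨ (|x j| = |x i| ∧ j < i)) → rank j < rank i := by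
    intro i j hij
    refine Finset.card_lt_card (Finset.ssubset_iff_of_subset ?_ |>.2 ⟨j, ?_, ?_⟩)
    · intro l hl
      simp only [Finset.mem_filter, Finset.mem_univ, true_and] at hl ⊢
      rcases hij with h | ⟨h, h'⟩ <;> rcases hl with g | ⟨g, g'⟩
      · exact Or.inl (h.trans g)
      · exact Or.inl (g ▸ h)
      · exact Or.inl (h ▸ g)
      · exact Or.inr ⟨g.trans h, g'.trans h'⟩
    · simpa using hij
    · simp
  have hinj : Function.Injective rank := by
    intro i j hij
    by_contra hne
    rcases lt_trichotomy |x i| |x j| with h | h | h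
    · exact absurd hij (hlt i j (Or.inl h)).ne'
    · rcases lt_or_gt_of_ne hne with h' | h'
      · exact absurd hij (hlt j i (Or.inr ⟨h, h'⟩)).ne
      · exact absurd hij (hlt i j (Or.inr ⟨h.symm, h'⟩)).ne'
    · exact absurd hij (hlt j i (Or.inl h)).ne
  have := Finset.card_le_card_of_injOn (s := largestSupport k x) (t := Finset.range k) rank
    (fun i hi => by simpa [largestSupport, hrank] using hi) hinj.injOn
  simpa using this

lemma l1Norm_sub_largest (k : ℕ) (x : Fin d → ℝ) :
    l1Norm (x - largest k x) = ∑ i, if i ∈ largestSupport k x then 0 else |x i| := by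
  rw [l1Norm_eq_sum]
  refine Finset.sum_congr rfl fun i _ => ?_
  simp only [largestSupport, Finset.mem_filter, Finset.mem_univ, true_and, Pi.sub_apply, largest]
  split_ifs <;> simp

/-- The analysis coefficients of `(f, e)` are concentrated on at most `k + s'` coordinates. -/
lemma exists_support (D : Matrix (Fin n) (Fin d) ℝ) (Ω : Matrix (Fin m) (Fin M) ℝ)
    (f : Fin n → ℝ) (e : Fin m → ℝ) {s' : ℕ} (he : hammingNorm (Ωᵀ *ᵥ e) ≤ s') (k : ℕ) :
    ∃ T : Finset (Fin d ⊕ Fin M), (T.card : ℝ) ≤ (k : ℝ) + s' ∧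
      ∑ i ∈ Tᶜ, |((blockFrame D Ω)ᵀ *ᵥ Sum.elim f e) i| ≤
        l1Norm (Dᵀ *ᵥ f - largest k (Dᵀ *ᵥ f)) := by
  refine ⟨(largestSupport k (Dᵀ *ᵥ f)).disjSum
    (Finset.univ.filter fun i => (Ωᵀ *ᵥ e) i ≠ 0), ?_, ?_⟩
  · rw [Finset.card_disjSum]
    push_cast
    gcongr
    · exact card_largestSupport_le _ _
    · exact he
  · have hx : (blockFrame D Ω)ᵀ *ᵥ Sum.elim f e = Sum.elim (Dᵀ *ᵥ f) (Ωᵀ *ᵥ e) := by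
      simp [blockFrame, Matrix.fromBlocks_transpose, Matrix.fromBlocks_mulVec]
    set T := (largestSupport k (Dᵀ *ᵥ f)).disjSum
      (Finset.univ.filter fun i => (Ωᵀ *ᵥ e) i ≠ 0) with hT
    have hTc : Tᶜ = Finset.univ.filter (· ∉ T) := by ext; simp
    rw [hx, l1Norm_sub_largest, hTc, Finset.sum_filter, Fintype.sum_sum_type]
    have h2 : ∀ i : Fin M, (if Sum.inr i ∉ T then |Sum.elim (Dᵀ *ᵥ f) (Ωᵀ *ᵥ e) (Sum.inr i)|
        else 0) = 0 := fun i => by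
      by_cases hi : (Ωᵀ *ᵥ e) i = 0 <;> simp [hT, hi]
    rw [Finset.sum_congr rfl fun i _ => h2 i, Finset.sum_const_zero, add_zero]
    simp only [hT, Finset.inl_mem_disjSum, ite_not, Sum.elim_inl, le_refl]

end Frames

/-! ### Error bounds for the three programs -/

section Programs

variable {ι κ μ : Type*} [Fintype ι] [Fintype κ] [Fintype μ] [DecidableEq ι] [DecidableEq κ]
  {Φ : Matrix μ ι ℝ} {W : Matrix ι κ ℝ} {L : ℕ} {K R : ℝ} {T : Finset κ} {u û : ι → ℝ}
  {y z : μ → ℝ}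

/-- Common core of SADS and SALASSO: `‖Φ h‖₂²` is bounded linearly in `‖Wᵀ h‖₁`, hence in `‖h‖₂` by
the cone estimate, which closes a quadratic inequality. -/
lemma l2Norm_le_of_sq_le (hW : W * Wᵀ = 1)
    (hstab : ∀ h, 1 / 10 * l2Norm h ≤
      l2Norm (Φ *ᵥ h) + 4 * (l1Norm (Wᵀ *ᵥ h) / √((102400 * L : ℕ) : ℝ)))
    (hK : 0 < K) (hKL : K ≤ L) (hT : T.card ≤ K) (hR : ∑ i ∈ Tᶜ, |(Wᵀ *ᵥ u) i| ≤ R)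
    (hcone : l1Norm (Wᵀ *ᵥ û) ≤ l1Norm (Wᵀ *ᵥ u) + 1 / 2 * l1Norm (Wᵀ *ᵥ (û - u)))
    {τ : ℝ} (hτ : 0 ≤ τ)
    (hΦ : l2Norm (Φ *ᵥ (û - u)) ^ 2 ≤ 3 * τ * l1Norm (Wᵀ *ᵥ (û - u))) :
    l2Norm (û - u) ≤ 28800 * √K * τ + 2 * (R / √K) := by
  have hsK : 0 < √K := Real.sqrt_pos.2 hK
  have hR0 : 0 ≤ R := (Finset.sum_nonneg fun _ _ => abs_nonneg _).trans hR
  have hsum : Wᵀ *ᵥ u + Wᵀ *ᵥ (û - u) = Wᵀ *ᵥ û := by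
    rw [← Matrix.mulVec_add, add_sub_cancel]
  have hl1 := l1Norm_le_of_cone _ (Wᵀ *ᵥ (û - u)) T hT hR (by rw [hsum]; exact hcone)
  rw [l2Norm_transpose_mulVec hW] at hl1
  have h1 := l2Norm_le_of_cone hstab hK hKL hl1
  have h2 := le_add_of_sq_le (t := √K * τ) (r := R / √K) (by positivity) (by positivity)
    (l2Norm_nonneg _) h1 (by
      refine hΦ.trans ((mul_le_mul_of_nonneg_left hl1 (by positivity)).trans_eq ?_)
      field_simp
      ring)
  linarith

/-- `u` is feasible, which gives the cone; the two residual constraints give `‖Wᵀ Φᵀ Φ h‖_∞ ≤ 2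
lam`, and `ℓ¹`-`ℓ^∞` duality bounds `‖Φ h‖₂²`. -/
lemma l2Norm_sub_le_of_isSADS (hW : W * Wᵀ = 1)
    (hstab : ∀ h, 1 / 10 * l2Norm h ≤
      l2Norm (Φ *ᵥ h) + 4 * (l1Norm (Wᵀ *ᵥ h) / √((102400 * L : ℕ) : ℝ)))
    (hK : 0 < K) (hKL : K ≤ L) (hT : T.card ≤ K) (hR : ∑ i ∈ Tᶜ, |(Wᵀ *ᵥ u) i| ≤ R)
    (hy : y = Φ *ᵥ u + z) {lam : ℝ} (hz : linftyNorm (Wᵀ *ᵥ (Φᵀ *ᵥ z)) ≤ lam)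
    (hû : IsSADS Φ W y lam û) :
    l2Norm (û - u) ≤ 28800 * √K * lam + 2 * (R / √K) := by
  have hl1 : 0 ≤ l1Norm (Wᵀ *ᵥ (û - u)) := norm_nonneg _
  have hlam : 0 ≤ lam := (norm_nonneg _).trans hz
  have hfeas : linftyNorm (Wᵀ *ᵥ (Φᵀ *ᵥ (Φ *ᵥ û - y))) ≤ lam := hû.1
  refine l2Norm_le_of_sq_le hW hstab hK hKL hT hR ?_ hlam ?_
  · have h1 : l1Norm (Wᵀ *ᵥ û) ≤ l1Norm (Wᵀ *ᵥ u) := hû.2 u (by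
      have : Φ *ᵥ u - y = -z := by rw [hy]; abel
      simp only [Set.mem_ofPred_eq, this, Matrix.mulVec_neg]
      rw [linftyNorm, norm_neg]
      exact hz)
    linarith
  · have h2 : linftyNorm (Wᵀ *ᵥ (Φᵀ *ᵥ (Φ *ᵥ (û - u)))) ≤ 2 * lam := by
      have : Φ *ᵥ (û - u) = (Φ *ᵥ û - y) + z := by rw [hy, Matrix.mulVec_sub]; abel
      rw [this, Matrix.mulVec_add, Matrix.mulVec_add]
      refine (norm_add_le _ _).trans ?_
      have h3 : ‖Wᵀ *ᵥ (Φᵀ *ᵥ (Φ *ᵥ û - y))‖ ≤ lam := hfeas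
      have h4 : ‖Wᵀ *ᵥ (Φᵀ *ᵥ z)‖ ≤ lam := hz
      linarith
    have h5 : l2Norm (Φ *ᵥ (û - u)) ^ 2 =
        (Wᵀ *ᵥ (û - u)) ⬝ᵥ (Wᵀ *ᵥ (Φᵀ *ᵥ (Φ *ᵥ (û - u)))) := by
      rw [dotProduct_transpose_mulVec hW, l2Norm_sq_eq_dotProduct,
        Matrix.dotProduct_mulVec (û - u) Φᵀ, Matrix.vecMul_transpose]
    rw [h5]
    refine (dotProduct_le_l1Norm_mul _ _).trans ?_
    nlinarith

/-- Only the objective values at `û` and `u` are compared. The noise term costs `(mu / 2) ‖Wᵀ h‖₁`,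
hence the `1 / 2` in the cone. No optimality condition is used, so `‖DᵀD‖_{1,1}` does not enter. -/
lemma l2Norm_sub_le_of_isSALASSO (hW : W * Wᵀ = 1)
    (hstab : ∀ h, 1 / 10 * l2Norm h ≤
      l2Norm (Φ *ᵥ h) + 4 * (l1Norm (Wᵀ *ᵥ h) / √((102400 * L : ℕ) : ℝ)))
    (hK : 0 < K) (hKL : K ≤ L) (hT : T.card ≤ K) (hR : ∑ i ∈ Tᶜ, |(Wᵀ *ᵥ u) i| ≤ R)
    (hy : y = Φ *ᵥ u + z) {mu : ℝ} (hmu : 0 < mu)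
    (hz : linftyNorm (Wᵀ *ᵥ (Φᵀ *ᵥ z)) ≤ mu / 2) (hû : IsSALASSO Φ W y mu û) :
    l2Norm (û - u) ≤ 28800 * √K * mu + 2 * (R / √K) := by
  have hl1 : 0 ≤ l1Norm (Wᵀ *ᵥ (û - u)) := norm_nonneg _
  have hopt : 1 / 2 * l2Norm (Φ *ᵥ û - y) ^ 2 + mu * l1Norm (Wᵀ *ᵥ û) ≤
      1 / 2 * l2Norm (Φ *ᵥ u - y) ^ 2 + mu * l1Norm (Wᵀ *ᵥ u) := hû.2 u (Set.mem_univ _)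
  have hexp : l2Norm (Φ *ᵥ û - y) ^ 2 = l2Norm (Φ *ᵥ (û - u)) ^ 2 -
      2 * (Φ *ᵥ (û - u) ⬝ᵥ z) + l2Norm (Φ *ᵥ u - y) ^ 2 := by
    have h1 : Φ *ᵥ û - y = Φ *ᵥ (û - u) - z := by rw [hy, Matrix.mulVec_sub]; abel
    have h2 : Φ *ᵥ u - y = -z := by rw [hy]; abel
    rw [h1, h2]
    simp only [l2Norm_sq_eq_dotProduct, sub_dotProduct, dotProduct_sub, neg_dotProduct,
      dotProduct_neg, neg_neg, dotProduct_comm z (Φ *ᵥ (û - u))]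
    ring
  have hcross : Φ *ᵥ (û - u) ⬝ᵥ z ≤ l1Norm (Wᵀ *ᵥ (û - u)) * (mu / 2) := by
    have : Φ *ᵥ (û - u) ⬝ᵥ z = (Wᵀ *ᵥ (û - u)) ⬝ᵥ (Wᵀ *ᵥ (Φᵀ *ᵥ z)) := by
      rw [dotProduct_transpose_mulVec hW, Matrix.dotProduct_mulVec, Matrix.vecMul_transpose]
    rw [this]
    exact (dotProduct_le_l1Norm_mul _ _).trans (mul_le_mul_of_nonneg_left hz hl1)
  have htri : l1Norm (Wᵀ *ᵥ u) ≤ l1Norm (Wᵀ *ᵥ û) + l1Norm (Wᵀ *ᵥ (û - u)) := by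
    have h := norm_sub_le (WithLp.toLp 1 (Wᵀ *ᵥ û)) (WithLp.toLp 1 (Wᵀ *ᵥ (û - u)))
    rwa [← WithLp.toLp_sub, ← Matrix.mulVec_sub, sub_sub_cancel] at h
  refine l2Norm_le_of_sq_le hW hstab hK hKL hT hR ?_ hmu.le ?_
  · refine le_of_mul_le_mul_left ?_ hmu
    nlinarith [sq_nonneg (l2Norm (Φ *ᵥ (û - u)))]
  · nlinarith [mul_le_mul_of_nonneg_left htri hmu.le]

/-- Both `û` and `u` are feasible, so `‖Φ h‖₂ ≤ 2 ε` directly and no quadratic inequality is needed.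
-/
lemma l2Norm_sub_le_of_isSABP (hW : W * Wᵀ = 1)
    (hstab : ∀ h, 1 / 10 * l2Norm h ≤
      l2Norm (Φ *ᵥ h) + 4 * (l1Norm (Wᵀ *ᵥ h) / √((102400 * L : ℕ) : ℝ)))
    (hK : 0 < K) (hKL : K ≤ L) (hT : T.card ≤ K) (hR : ∑ i ∈ Tᶜ, |(Wᵀ *ᵥ u) i| ≤ R)
    (hy : y = Φ *ᵥ u + z) {ε : ℝ} (hz : l2Norm z ≤ ε) (hû : IsSABP Φ W y ε û) :
    l2Norm (û - u) ≤ 40 * ε + R / √K := by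
  have hl1 : 0 ≤ l1Norm (Wᵀ *ᵥ (û - u)) := norm_nonneg _
  have hfeas : l2Norm (Φ *ᵥ û - y) ≤ ε := hû.1
  have hmin : l1Norm (Wᵀ *ᵥ û) ≤ l1Norm (Wᵀ *ᵥ u) := hû.2 u (by
    have : Φ *ᵥ u - y = 0 - z := by rw [hy]; abel
    simp only [Set.mem_ofPred_eq, this]
    refine (l2Norm_sub_le _ _).trans ?_
    rwa [l2Norm_zero, zero_add])
  have hsum : Wᵀ *ᵥ u + Wᵀ *ᵥ (û - u) = Wᵀ *ᵥ û := by
    rw [← Matrix.mulVec_add, add_sub_cancel]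
  have hcone := l1Norm_le_of_cone _ (Wᵀ *ᵥ (û - u)) T hT hR (by rw [hsum]; linarith)
  rw [l2Norm_transpose_mulVec hW] at hcone
  have h1 := l2Norm_le_of_cone hstab hK hKL hcone
  have h2 : l2Norm (Φ *ᵥ (û - u)) ≤ 2 * ε := by
    have : Φ *ᵥ (û - u) = (Φ *ᵥ û - y) + z := by rw [hy, Matrix.mulVec_sub]; abel
    rw [this]
    exact (l2Norm_add_le _ _).trans (by linarith)
  linarith

end Programs

/-! ### Assembly -/

theorem mainTheorem7 :
    ∃ C c : ℝ, 0 < C ∧ 0 < c ∧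
    ∀ δ : ℝ, 0 < δ → δ < 1 / 4 →
    ∃ C₀ C₁ C₂ C₃ C₄ C₅ : ℝ, 0 < C₀ ∧ 0 < C₁ ∧ 0 < C₂ ∧ 0 < C₃ ∧ 0 < C₄ ∧ 0 < C₅ ∧
    ∀ (n d m M s s' : ℕ) (D : Matrix (Fin n) (Fin d) ℝ) (Ω : Matrix (Fin m) (Fin M) ℝ),
    IsTightFrame D → IsTightFrame Ω →
    0 < s + s' → 2 * (s + s') ≤ d + M →
    C * (δ ^ 2)⁻¹ * ((s : ℝ) + s') * Real.log (((d : ℝ) + M) / ((s : ℝ) + s')) ≤ m →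
    ∀ (S : Type*) [MeasurableSpace S] (P : Measure S) [IsProbabilityMeasure P]
      (A : S → Matrix (Fin m) (Fin n) ℝ), IsGaussianMatrix A P →
    ∃ E : Set S, MeasurableSet E ∧ 1 - 3 * Real.exp (-(c * m)) ≤ P.real E ∧
    ∀ ω ∈ E, ∀ (f : Fin n → ℝ) (e z y : Fin m → ℝ),
    hammingNorm (Ωᵀ *ᵥ e) ≤ s' → y = A ω *ᵥ f + z + e →
    (∀ lam : ℝ, linftyNorm ((blockFrame D Ω)ᵀ *ᵥ ((phi (A ω))ᵀ *ᵥ z)) ≤ lam →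
      ∀ û, IsSADS (phi (A ω)) (blockFrame D Ω) y lam û →
        l2Norm (û ∘ Sum.inl - f) ≤ l2Norm (û - Sum.elim f e) ∧
        ∀ k : ℕ, 1 ≤ k → k ≤ s →
          l2Norm (û - Sum.elim f e) ≤
            C₀ * √((k : ℝ) + s') * lam +
              C₁ * (l1Norm (Dᵀ *ᵥ f - largest k (Dᵀ *ᵥ f)) / √((k : ℝ) + s'))) ∧
    (∀ mu : ℝ, 0 < mu → linftyNorm ((blockFrame D Ω)ᵀ *ᵥ ((phi (A ω))ᵀ *ᵥ z)) ≤ mu / 2 →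
      ∀ û, IsSALASSO (phi (A ω)) (blockFrame D Ω) y mu û →
        l2Norm (û ∘ Sum.inl - f) ≤ l2Norm (û - Sum.elim f e) ∧
        ∀ k : ℕ, 1 ≤ k → k ≤ s →
          l2Norm (û - Sum.elim f e) ≤
            C₂ * (1 + 2 * norm11 (Dᵀ * D)) * √((k : ℝ) + s') * mu +
              C₃ * (l1Norm (Dᵀ *ᵥ f - largest k (Dᵀ *ᵥ f)) / √((k : ℝ) + s'))) ∧
    (∀ ε : ℝ, l2Norm z ≤ ε →
      ∀ û, IsSABP (phi (A ω)) (blockFrame D Ω) y ε û →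
        l2Norm (û ∘ Sum.inl - f) ≤ l2Norm (û - Sum.elim f e) ∧
        l2Norm (û - Sum.elim f e) ≤
          C₄ * ε + C₅ * (l1Norm (Dᵀ *ᵥ f - largest s (Dᵀ *ᵥ f)) / √((s : ℝ) + s'))) := by
  -- As `δ < 1/4` gives `δ⁻² ≥ 16`, and `12 · 16 = 8 · 24`, there are at most `exp (m / 24)` test
  -- vectors. Against the failure rate `exp (-m / 12)` this leaves `c = 1/24`. The error constants
  -- are absolute.
  refine ⟨12 * 102400, 1 / 24, by norm_num, by norm_num, fun δ hδ hδ4 =>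
    ⟨28800, 2, 28800, 2, 40, 1, by norm_num, by norm_num, by norm_num, by norm_num, by norm_num,
      by norm_num, ?_⟩⟩
  intro n d m M s s' D Ω hD hΩ hs hsd hm S _ P _ A hA
  have hL : (0 : ℝ) < (s : ℝ) + s' := by exact_mod_cast hs
  have hlog : 0 < Real.log (((d : ℝ) + M) / ((s : ℝ) + s')) := by
    refine Real.log_pos ?_
    rw [one_lt_div hL]
    have : (2 : ℝ) * (s + s') ≤ d + M := by exact_mod_cast hsd
    linarith
  have hm' : 8 * (102400 * ((s : ℝ) + s')) * Real.log (((d : ℝ) + M) / ((s : ℝ) + s')) ≤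
      m / 24 := by
    have hδ' : (16 : ℝ) ≤ (δ ^ 2)⁻¹ := by
      rw [le_inv_comm₀ (by norm_num) (by positivity)]
      nlinarith
    have h1 : (12 * 102400) * 16 * (((s : ℝ) + s') * Real.log (((d : ℝ) + M) / ((s : ℝ) + s'))) ≤
        (12 * 102400) * (δ ^ 2)⁻¹ *
          (((s : ℝ) + s') * Real.log (((d : ℝ) + M) / ((s : ℝ) + s'))) := by
      gcongr
    linarith
  have hm0 : 0 < m := by
    have : (0 : ℝ) < m := by
      have h2 : 0 < 8 * (102400 * ((s : ℝ) + s')) *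
        Real.log (((d : ℝ) + M) / ((s : ℝ) + s')) := by positivity
      linarith
    exact_mod_cast this
  have hW := blockFrame_mul_transpose hD hΩ
  obtain ⟨N, hNcard, hN⟩ := exists_test_vectors (μ := Fin m) (blockFrame D Ω) (102400 * (s + s'))
  have hcount := choose_mul_pow_le_exp (q := 102400) (by norm_num) hs hsd
  simp only [Fintype.card_sum, Fintype.card_fin] at hNcard
  obtain ⟨E, hE, hPE, hEgood⟩ := exists_event_phi_mulVec hm0 hA N
  refine ⟨E, hE, ?_, ?_⟩
  · have h1 : (N.card : ℝ) ≤ Real.exp (m / 24) := by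
      refine (Nat.cast_le.2 hNcard).trans (hcount.trans (Real.exp_le_exp.2 ?_))
      push_cast
      exact hm'
    have h2 : Real.exp (m / 24 : ℝ) * Real.exp (-(m / 12 : ℝ)) =
        Real.exp (-(1 / 24 * m : ℝ)) := by
      rw [← Real.exp_add]; congr 1; ring
    have h3 : N.card * (2 * Real.exp (-(m / 12 : ℝ))) ≤ 2 * Real.exp (-(1 / 24 * m : ℝ)) := by
      rw [← h2]
      have := mul_le_mul_of_nonneg_right h1 (Real.exp_pos (-(m / 12 : ℝ))).le
      linarith
    have := Real.exp_pos (-(1 / 24 * m : ℝ))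
    linarith
  intro ω hω f e z y he hy
  have hstab := l2Norm_le_of_sparse_bounds hW (Q := 102400 * (s + s')) (by omega)
    (hN (phi (A ω)) (hEgood ω hω))
  have hy' : y = phi (A ω) *ᵥ Sum.elim f e + z := by
    rw [hy, phi, Matrix.fromCols_mulVec]
    simp only [Sum.elim_comp_inl, Sum.elim_comp_inr, Matrix.one_mulVec]
    abel
  refine ⟨fun lam hlam û hû => ⟨l2Norm_inl_sub_le û f e, fun k hk hks => ?_⟩,
    fun mu hmu hz û hû => ⟨l2Norm_inl_sub_le û f e, fun k hk hks => ?_⟩,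
    fun ε hz û hû => ⟨l2Norm_inl_sub_le û f e, ?_⟩⟩
  · obtain ⟨T, hT, hR⟩ := exists_support D Ω f e he k
    exact l2Norm_sub_le_of_isSADS hW hstab (by positivity) (by push_cast; gcongr) hT hR hy'
      hlam hû
  · obtain ⟨T, hT, hR⟩ := exists_support D Ω f e he k
    refine (l2Norm_sub_le_of_isSALASSO hW hstab (by positivity) (by push_cast; gcongr) hT hR hy'
      hmu hz hû).trans ?_
    -- The bound just obtained is stronger than required: the factor `1 + 2 ‖DᵀD‖_{1,1}` is at least
    -- 1.
    have h11 : 0 ≤ norm11 (Dᵀ * D) := norm_nonneg _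
    have h1 : 28800 * √((k : ℝ) + s') * mu ≤
        28800 * (1 + 2 * norm11 (Dᵀ * D)) * √((k : ℝ) + s') * mu := by
      gcongr
      linarith
    linarith
  · obtain ⟨T, hT, hR⟩ := exists_support D Ω f e he s
    rw [one_mul]
    exact l2Norm_sub_le_of_isSABP hW hstab hL (by push_cast; rfl) hT hR hy' hz hû
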